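/- Let $N\cong\mathbb Z^n$ be a lattice, $N_{\mathbb R}=N\otimes_{\mathbb Z}\mathbb R$, and let $\Sigma$ be a simplicial fan in $N_{\mathbb R}$, i.e. a finite collection of strongly convex cones, each spanned by lattice vectors forming part of a basis of $N_{\mathbb R}$, closed under passing to faces and such that any two cones intersect in a common face. Let $a_1,\dots,a_m\in N$ be the primitive generators of the one-dimensional cones of $\Sigma$, listed without repetition in any order. For $\sigma\in\Sigma$ let $g(\sigma)\subseteq\{1,\dots,m\}$ be the set of $i$ such that $a_i$ is a generator of $\sigma$ (a member of a minimal set of lattice vectors spanning $\sigma$), and call $I\subseteq\{1,\dots,m\}$ a g-subset if $I\subseteq g(\sigma)$ for some $\sigma\in\Sigma$. Put $$U(\Sigma)=\mathbb C^m\setminus\bigcup_{I\text{ not a g-subset}}\{z: z_i=0\text{ for all } i\in I\},$$ $$\mathcal Z(\Sigma)=\bigcup_{\sigma\in\Sigma}\{z\in\mathbb C^m: |z_j|\le 1\text{ for all }j,\ |z_j|=1\text{ for } j\notin g(\sigma)\}\subseteq U(\Sigma).$$ Let $G\subseteq(\mathbb C^*)^m$ and $K\subseteq\mathbb T^m=(\mathbb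 S^1)^m$ be the kernels of the homomorphisms $(\mathbb C^*)^m\to N\otimes_{\mathbb Z}\mathbb C^*$ and $\mathbb T^m\to N\otimes_{\mathbb Z}\mathbb S^1$ induced by the map $\mathbb Z^m\to N$, $e_i\mapsto a_i$. These groups act coordinatewise on $\mathbb C^m$, with $G$ preserving $U(\Sigma)$ and $K$ preserving $\mathcal Z(\Sigma)$, and the orbit spaces carry the quotient topology. (a) If $\Sigma$ is complete, i.e. its cones cover $N_{\mathbb R}$, then the composition $\mathcal Z(\Sigma)\hookrightarrow U(\Sigma)\to U(\Sigma)/G$ induces a homeomorphism $\mathcal Z(\Sigma)/K\to U(\Sigma)/G$. (b) There is a $\mathbb T^m$-equivariant deformation retraction of $U(\Sigma)$ to $\mathcal Z(\Sigma)$: a continuous map $H:[0,1]\times U(\Sigma)\to U(\Sigma)$ with $H(0,z)=z$ and $H(1,z)\in\mathcal Z(\Sigma)$ for all $z\in U(\Sigma)$, with $H(s,z)=z$ for all $s\in[0,1]$ and $z\in\mathcal Z(\Sigma)$, and with $H(s,t\cdot z)=t\cdot H(s,z)$ for all $s\in[0,1]$, $t\in\mathbb T^m$ and $z\in U(\Sigma)$.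 -/

import Mathlib

open scoped TensorProduct

noncomputable section

namespace ToricKN

section Cones

variable {N : Type*} [AddCommGroup N]

/-- The image of a lattice vector `v ∈ N` in the real vector space `N_ℝ = ℝ ⊗ N`. -/
def toReal (v : N) : ℝ ⊗[ℤ] N := (1 : ℝ) ⊗ₜ[ℤ] v

/-- The cone `{∑ μ_v v : μ_v ≥ 0}` in `N_ℝ` spanned by a finite set `A` of lattice vectors. -/
def coneOf (A : Finset N) : PointedCone ℝ (ℝ ⊗[ℤ] N) :=
  PointedCone.hull ℝ (toReal '' (A : Set N))

/-- `A` is a generator set of the cone `σ`: a minimal finite set of lattice vectors spanning `σ`.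
For a strongly convex cone such a set is unique up to positive rescaling of its members. -/
def IsGeneratorSet (σ : PointedCone ℝ (ℝ ⊗[ℤ] N)) (A : Finset N) : Prop :=
  Minimal (fun B : Finset N => coneOf B = σ) A

/-- `σ` contains no line. -/
def StronglyConvex (σ : PointedCone ℝ (ℝ ⊗[ℤ] N)) : Prop :=
  ∀ x, x ∈ σ → -x ∈ σ → x = 0

/-- `τ` is a face of `σ`: it is cut out of `σ` by the zero set of a linear functional which is
nonnegative on `σ` (the zero functional gives `σ` as a face of itself). -/
def IsFace (τ σ : PointedCone ℝ (ℝ ⊗[ℤ] N)) : Prop :=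
  ∃ f : (ℝ ⊗[ℤ] N) →ₗ[ℝ] ℝ, (∀ x ∈ σ, 0 ≤ f x) ∧ ∀ x, x ∈ τ ↔ x ∈ σ ∧ f x = 0

/-- `σ` is spanned by lattice vectors that form part of a real basis of `N_ℝ`. -/
def IsSimplicialCone (σ : PointedCone ℝ (ℝ ⊗[ℤ] N)) : Prop :=
  ∃ A : Finset N, coneOf A = σ ∧ LinearIndepOn ℝ (toReal : N → ℝ ⊗[ℤ] N) (A : Set N)

/-- `σ` has dimension one. -/
def IsOneDimensional (σ : PointedCone ℝ (ℝ ⊗[ℤ] N)) : Prop :=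
  Module.finrank ℝ (Submodule.span ℝ (σ : Set (ℝ ⊗[ℤ] N))) = 1

/-- `v` is a primitive vector of the lattice `N`: nonzero and not a proper multiple. -/
def IsPrimitive (v : N) : Prop :=
  v ≠ 0 ∧ ∀ (k : ℤ) (w : N), v = k • w → IsUnit k

end Cones

/-- A fan in `N_ℝ`: a finite collection of strongly convex rational polyhedral cones, closed under
passing to faces, such that any two of its cones intersect in a common face. -/
structure Fan (N : Type*) [AddCommGroup N] where
  cones : Set (PointedCone ℝ (ℝ ⊗[ℤ] N))
  finite : cones.Finite
  rational : ∀ σ ∈ cones, ∃ A : Finset N, coneOf A = σ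
  stronglyConvex : ∀ σ ∈ cones, StronglyConvex σ
  face_mem : ∀ σ ∈ cones, ∀ τ, IsFace τ σ → τ ∈ cones
  inter_face : ∀ σ ∈ cones, ∀ τ ∈ cones, IsFace (σ ⊓ τ) σ ∧ IsFace (σ ⊓ τ) τ

section TorusMap

variable {N : Type*} [AddCommGroup N] {m : ℕ}

/-- For an abelian group `C`, the map of tori `C^m → N ⊗ C` induced by the lattice map
`ℤ^m → N`, `e_i ↦ a_i`; explicitly `(t_1, …, t_m) ↦ ∑ a_i ⊗ t_i`
(the abelian group `N ⊗ C` is written additively inside the tensor product). -/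
def torusMap (a : Fin m → N) (C : Type*) [CommGroup C] :
    (Fin m → C) →* Multiplicative (N ⊗[ℤ] Additive C) where
  toFun t := Multiplicative.ofAdd (∑ i, a i ⊗ₜ[ℤ] Additive.ofMul (t i))
  map_one' := by simp
  map_mul' s t := by
    simp [TensorProduct.tmul_add, Finset.sum_add_distrib, ofAdd_add]

/-- The group `G`, the kernel of `(ℂ^*)^m → T_ℂ = N ⊗ ℂ^*`. -/
def groupG (a : Fin m → N) : Subgroup (Fin m → ℂˣ) := (torusMap a ℂˣ).ker

/-- The group `K`, the kernel of `𝕋^m → T = N ⊗ 𝕊¹`. -/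
def groupK (a : Fin m → N) : Subgroup (Fin m → Circle) := (torusMap a Circle).ker

/-- The inclusion `𝕋^m ↪ (ℂ^*)^m`. -/
def torusIncl (m : ℕ) : (Fin m → Circle) →* (Fin m → ℂˣ) where
  toFun t i := Circle.toUnits (t i)
  map_one' := by ext; simp
  map_mul' s t := by ext; simp

end TorusMap

namespace Fan

variable {N : Type*} [AddCommGroup N] {m : ℕ}

/-- Every cone of the fan is simplicial. -/
def IsSimplicial (F : Fan N) : Prop := ∀ σ ∈ F.cones, IsSimplicialCone σ

/-- The cones of the fan cover `N_ℝ`. -/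
def IsComplete (F : Fan N) : Prop := ∀ x : ℝ ⊗[ℤ] N, ∃ σ ∈ F.cones, x ∈ σ

/-- `a_1, …, a_m` are the primitive generators of the one-dimensional cones of the fan, each
one-dimensional cone being listed exactly once. -/
def IsRayEnumeration (F : Fan N) (a : Fin m → N) : Prop :=
  (∀ i, IsPrimitive (a i)) ∧
    Set.BijOn (fun i => coneOf {a i}) Set.univ {σ | σ ∈ F.cones ∧ IsOneDimensional σ}

/-- `g(σ) ⊆ [m]`: the indices `i` for which `a_i` belongs to a generator set of `σ`. -/
def gens (a : Fin m → N) (σ : PointedCone ℝ (ℝ ⊗[ℤ] N)) : Set (Fin m) :=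
  {i | ∃ A : Finset N, IsGeneratorSet σ A ∧ a i ∈ A}

/-- `I ⊆ [m]` is a g-subset: the `a_i`, `i ∈ I`, are among the generators of some cone of the
fan. -/
def IsGSubset (F : Fan N) (a : Fin m → N) (I : Set (Fin m)) : Prop :=
  ∃ σ ∈ F.cones, I ⊆ gens a σ

/-- The coordinate subspace arrangement `A(Σ)`. -/
def arrangement (F : Fan N) (a : Fin m → N) : Set (Fin m → ℂ) :=
  ⋃ I ∈ {I : Set (Fin m) | ¬ F.IsGSubset a I}, {z | ∀ i ∈ I, z i = 0}

/-- `U(Σ) = ℂ^m ∖ A(Σ)`, with the coordinatewise action of `(ℂ^*)^m`. -/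
def U (F : Fan N) (a : Fin m → N) : SubMulAction (Fin m → ℂˣ) (Fin m → ℂ) where
  carrier := (F.arrangement a)ᶜ
  smul_mem' t z hz := by
    simp only [arrangement, Set.mem_compl_iff, Set.mem_iUnion, Set.mem_ofPred_eq, not_exists]
      at hz ⊢
    intro I hI h
    refine hz I hI fun i hi => ?_
    have := h i hi
    simpa [Units.smul_def] using this

/-- `Z(σ) = {z ∈ (𝔻²)^m : |z_j| = 1 if j ∉ g(σ)}`. -/
def ZCone (a : Fin m → N) (σ : PointedCone ℝ (ℝ ⊗[ℤ] N)) : Set (Fin m → ℂ) :=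
  {z | (∀ j, ‖z j‖ ≤ 1) ∧ ∀ j, j ∉ gens a σ → ‖z j‖ = 1}

/-- The moment-angle complex `Z(Σ)`, the union of the `Z(σ)` over all cones of the fan, with the
coordinatewise action of `𝕋^m`. -/
def Z (F : Fan N) (a : Fin m → N) : SubMulAction (Fin m → Circle) (Fin m → ℂ) where
  carrier := ⋃ σ ∈ F.cones, ZCone a σ
  smul_mem' t z hz := by
    have hn : ∀ j, ‖(t • z) j‖ = ‖z j‖ := fun j => by
      have h : (t • z) j = (t j : ℂ) * z j := rfl
      rw [h, norm_mul, Circle.norm_coe, one_mul]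
    simpa only [Set.mem_iUnion, ZCone, Set.mem_ofPred_eq, hn] using hz

theorem Z_subset_U (F : Fan N) (a : Fin m → N) {z : Fin m → ℂ} (hz : z ∈ F.Z a) :
    z ∈ F.U a := by
  change z ∈ ⋃ σ ∈ F.cones, ZCone a σ at hz
  obtain ⟨σ, hσ, -, h2⟩ := Set.mem_iUnion₂.1 hz
  change z ∈ (F.arrangement a)ᶜ
  simp only [arrangement, Set.mem_compl_iff, Set.mem_iUnion, Set.mem_ofPred_eq, not_exists]
  intro I hI h
  refine hI ⟨σ, hσ, fun i hi => ?_⟩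
  by_contra hg
  have := h2 i hg
  rw [h i hi] at this
  simp at this

/-- The inclusion `Z(Σ) ↪ U(Σ)`. -/
def inclZU (F : Fan N) (a : Fin m → N) (z : F.Z a) : F.U a := ⟨z, F.Z_subset_U a z.2⟩

/-- `U(Σ)/G`, with the quotient topology. -/
abbrev UModG (F : Fan N) (a : Fin m → N) : Type :=
  MulAction.orbitRel.Quotient (groupG a) (F.U a)

/-- `Z(Σ)/K`, with the quotient topology. -/
abbrev ZModK (F : Fan N) (a : Fin m → N) : Type :=
  MulAction.orbitRel.Quotient (groupK a) (F.Z a)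

end Fan

end ToricKN

end

/-! Logarithms of absolute values turn the non-compact part of `G` into the space of real relations
∑ ξ_i a_i = 0: every element of `G` is an element of `K` times exp ξ for such a ξ (`exists_polar`).
Part (a) thus amounts to saying that for each z in U there is exactly one relation ξ with exp ξ · z
in Z, and that ξ depends continuously on z.

Uniqueness: if z and exp ξ · z both lie in Z, the sets {ξ > 0} and {ξ < 0} are g-subsets. The two
halves of the relation then give one point of two cones, which meet in a common face with
independent generators, so ξ = 0 (`eq_zero_of_sum_smul_eq_zero`). Existence: by completeness, adding
a large multiple of the sum of the a_i with z_i = 0 to ∑ -log|z_i| a_i (sum over z_i ≠ 0) reaches a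
cone having those a_i among its generators, and the coefficients there yield ξ
(`exists_relation_of_isComplete`). Continuity: relations escaping to infinity would have a limiting
direction that is a nonzero relation of the excluded kind (`not_tendsto_norm_atTop`).

For part (b), z_i is divided by max(|z_i|, `level` z), where `level` is continuous, positive on U,
equal to 1 on Z, and such that the coordinates of modulus below it form a g-subset. Straight lines
then give the homotopy. -/

namespace ToricKN

open scoped TensorProduct
open Filter Topology

/-! ### Cones, faces and separating functionals -/

section Cones

variable {N : Type*} [AddCommGroup N]

theorem toReal_mem_coneOf {A : Finset N} {v : N} (hv : v ∈ A) : toReal v ∈ coneOf A :=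
  Submodule.subset_span (Set.mem_image_of_mem _ hv)

theorem mem_coneOf_iff {A : Finset N} {x : ℝ ⊗[ℤ] N} :
    x ∈ coneOf A ↔ ∃ c : N → ℝ, (∀ v, 0 ≤ c v) ∧ ∑ v ∈ A, c v • toReal v = x := by
  classical
  constructor
  · intro h
    change x ∈ Submodule.span _ _ at h
    rw [Submodule.mem_span_image_finset_iff_exists_fun] at h
    obtain ⟨c, hc⟩ := h
    refine ⟨fun v => if hv : v ∈ A then c ⟨v, hv⟩ else 0, fun v => ?_, ?_⟩
    · dsimp only
      split_ifs
      exacts [(c _).2, le_rfl]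
    · rw [← hc, ← Finset.sum_attach, Finset.univ_eq_attach]
      refine Finset.sum_congr rfl fun v _ => ?_
      simp only [v.2, dif_pos]
      rfl
  · rintro ⟨c, hc, rfl⟩
    exact Submodule.sum_mem _ fun v hv =>
      Submodule.smul_mem _ (⟨c v, hc v⟩ : {r : ℝ // 0 ≤ r}) (toReal_mem_coneOf hv)

theorem mem_coneOf_singleton {v : N} {x : ℝ ⊗[ℤ] N} :
    x ∈ coneOf {v} ↔ ∃ c : ℝ, 0 ≤ c ∧ c • toReal v = x := by
  rw [mem_coneOf_iff]
  constructor
  · rintro ⟨c, hc, h⟩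
    exact ⟨c v, hc v, by simpa using h⟩
  · rintro ⟨c, hc, h⟩
    exact ⟨fun _ => c, fun _ => hc, by simpa using h⟩

theorem smul_mem_cone (σ : PointedCone ℝ (ℝ ⊗[ℤ] N)) {c : ℝ} (hc : 0 ≤ c) {x : ℝ ⊗[ℤ] N}
    (hx : x ∈ σ) : c • x ∈ σ :=
  Submodule.smul_mem σ (⟨c, hc⟩ : {r : ℝ // 0 ≤ r}) hx

/-- If a nonnegative combination of elements of `σ` lies in a face, then so does every element
occurring with a positive coefficient. -/
theorem IsFace.mem_of_sum_mem {τ σ : PointedCone ℝ (ℝ ⊗[ℤ] N)} (h : IsFace τ σ) {ι : Type*}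
    {s : Finset ι} {c : ι → ℝ} {w : ι → ℝ ⊗[ℤ] N} (hc : ∀ i ∈ s, 0 ≤ c i)
    (hw : ∀ i ∈ s, 0 < c i → w i ∈ σ) (hsum : ∑ i ∈ s, c i • w i ∈ τ) {i : ι} (hi : i ∈ s)
    (hci : 0 < c i) : w i ∈ τ := by
  obtain ⟨f, hf, hτ⟩ := h
  have h0 := ((hτ _).1 hsum).2
  simp only [map_sum, map_smul, smul_eq_mul] at h0
  have hnn : ∀ j ∈ s, 0 ≤ c j * f (w j) := fun j hj => by
    rcases (hc j hj).eq_or_lt with h | h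
    · simp [← h]
    · exact mul_nonneg h.le (hf _ (hw j hj h))
  have := (Finset.sum_eq_zero_iff_of_nonneg hnn).1 h0 i hi
  exact (hτ _).2 ⟨hw i hi hci, (mul_eq_zero.1 this).resolve_left hci.ne'⟩

theorem exists_dual_of_linearIndepOn {ι : Type*} {g : ι → ℝ ⊗[ℤ] N} {s : Set ι}
    (h : LinearIndepOn ℝ g s) (c : ι → ℝ) :
    ∃ f : (ℝ ⊗[ℤ] N) →ₗ[ℝ] ℝ, ∀ i ∈ s, f (g i) = c i := by
  have h' : LinearIndependent ℝ (fun i : s => g i) := h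
  obtain ⟨f, hf⟩ := LinearMap.exists_extend ((Module.Basis.span h').constr ℝ fun i : s => c i)
  refine ⟨f, fun i hi => ?_⟩
  have h1 := LinearMap.congr_fun hf (Module.Basis.span h' ⟨i, hi⟩)
  rw [Module.Basis.constr_basis] at h1
  rw [← h1]
  simp [Module.Basis.span_apply]

/-- A functional that is 0 on `v` and 1 on the other generators vanishes on the cone exactly along
the ray of `v`. -/
theorem isFace_coneOf_singleton {A : Finset N}
    (hA : LinearIndepOn ℝ (toReal : N → ℝ ⊗[ℤ] N) (A : Set N)) {v : N} (hv : v ∈ A) :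
    IsFace (coneOf {v}) (coneOf A) := by
  classical
  obtain ⟨f, hf⟩ := exists_dual_of_linearIndepOn hA (fun w => if w = v then 0 else 1)
  have key : ∀ c : N → ℝ, f (∑ w ∈ A, c w • toReal w) = ∑ w ∈ A.erase v, c w := fun c => by
    rw [map_sum, ← Finset.add_sum_erase _ _ hv]
    simp only [map_smul, smul_eq_mul, hf v hv, if_true, mul_zero, zero_add]
    refine Finset.sum_congr rfl fun w hw => ?_
    rw [hf w (Finset.mem_of_mem_erase hw), if_neg (Finset.ne_of_mem_erase hw), mul_one]
  refine ⟨f, fun x hx => ?_, fun x => ⟨fun hx => ?_, fun ⟨hx, h0⟩ => ?_⟩⟩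
  · obtain ⟨c, hc, rfl⟩ := mem_coneOf_iff.1 hx
    rw [key]
    exact Finset.sum_nonneg fun w _ => hc w
  · obtain ⟨c, hc, rfl⟩ := mem_coneOf_singleton.1 hx
    exact ⟨smul_mem_cone _ hc (toReal_mem_coneOf hv), by simp [hf v hv]⟩
  · obtain ⟨c, hc, rfl⟩ := mem_coneOf_iff.1 hx
    rw [key, Finset.sum_eq_zero_iff_of_nonneg fun w _ => hc w] at h0
    refine mem_coneOf_singleton.2 ⟨c v, hc v, ?_⟩
    rw [← Finset.add_sum_erase _ _ hv, Finset.sum_eq_zero, add_zero]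
    intro w hw
    rw [h0 w hw, zero_smul]

theorem isOneDimensional_coneOf_singleton {v : N} (hv : toReal v ≠ 0) :
    IsOneDimensional (coneOf {v}) := by
  have : Submodule.span ℝ ((coneOf {v} : PointedCone ℝ (ℝ ⊗[ℤ] N)) : Set (ℝ ⊗[ℤ] N)) =
      Submodule.span ℝ {toReal v} := by
    apply le_antisymm
    · refine Submodule.span_le.2 fun x hx => ?_
      obtain ⟨c, -, rfl⟩ := mem_coneOf_singleton.1 hx
      exact Submodule.smul_mem _ _ (Submodule.mem_span_singleton_self _)
    · refine Submodule.span_mono ?_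
      rw [Set.singleton_subset_iff]
      exact toReal_mem_coneOf (Finset.mem_singleton_self v)
  rw [IsOneDimensional, this, finrank_span_singleton hv]

/-- The coordinate functional of `v` kills every combination of a subset omitting `v`, so no
generator can be dropped. -/
theorem isGeneratorSet_of_linearIndepOn {A : Finset N}
    (hA : LinearIndepOn ℝ (toReal : N → ℝ ⊗[ℤ] N) (A : Set N)) : IsGeneratorSet (coneOf A) A := by
  classical
  refine ⟨rfl, fun B hB hBA v hv => ?_⟩
  by_contra hvB
  obtain ⟨f, hf⟩ := exists_dual_of_linearIndepOn hA (fun w => if w = v then 1 else 0)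
  have hB : coneOf B = coneOf A := hB
  have hmem : toReal v ∈ coneOf B := hB ▸ toReal_mem_coneOf hv
  obtain ⟨c, -, hc⟩ := mem_coneOf_iff.1 hmem
  have h1 := congrArg f hc
  rw [hf v hv, if_pos rfl, map_sum, Finset.sum_eq_zero] at h1
  · exact zero_ne_one h1
  · intro w hw
    rw [map_smul, hf w (hBA hw), if_neg (ne_of_mem_of_not_mem hw hvB), smul_zero]

theorem IsGeneratorSet.mem {σ : PointedCone ℝ (ℝ ⊗[ℤ] N)} {A : Finset N}
    (h : IsGeneratorSet σ A) {v : N} (hv : v ∈ A) : toReal v ∈ σ := by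
  have h1 : coneOf A = σ := h.1
  exact h1 ▸ toReal_mem_coneOf hv

theorem exists_pos_smul_of_coneOf_singleton_eq {v w : N} (h : coneOf {v} = coneOf {w})
    (hv : toReal v ≠ 0) : ∃ c : ℝ, 0 < c ∧ toReal v = c • toReal w := by
  have := toReal_mem_coneOf (Finset.mem_singleton_self v)
  rw [h] at this
  obtain ⟨c, hc, e⟩ := mem_coneOf_singleton.1 this
  refine ⟨c, hc.lt_of_ne fun h0 => hv ?_, e.symm⟩
  rw [← e, ← h0, zero_smul]

end Cones

/-! ### Ray generators of the cones of a simplicial fan -/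

namespace Fan

variable {N : Type*} [AddCommGroup N] {m : ℕ} {F : Fan N} {a : Fin m → N}
  {σ : PointedCone ℝ (ℝ ⊗[ℤ] N)}

theorem IsRayEnumeration.toReal_ne_zero (ha : F.IsRayEnumeration a) (i : Fin m) :
    toReal (a i) ≠ 0 := by
  intro h
  have h1 : IsOneDimensional (coneOf {a i}) := (ha.2.1 (Set.mem_univ i)).2
  have h0 : Submodule.span ℝ ((coneOf {a i} : PointedCone ℝ (ℝ ⊗[ℤ] N)) : Set (ℝ ⊗[ℤ] N)) = ⊥ := by
    refine Submodule.span_eq_bot.2 fun x hx => ?_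
    obtain ⟨c, -, rfl⟩ := mem_coneOf_singleton.1 hx
    rw [h, smul_zero]
  rw [IsOneDimensional, h0, finrank_bot] at h1
  exact zero_ne_one h1

theorem IsRayEnumeration.coneOf_mem (ha : F.IsRayEnumeration a) (i : Fin m) :
    coneOf {a i} ∈ F.cones := (ha.2.1 (Set.mem_univ i)).1

/-- A cone of the fan is spanned by a linearly independent subfamily of the ray generators, which
consists of the ray generators it contains. -/
theorem exists_generators (ha : F.IsRayEnumeration a) (hF : F.IsSimplicial) (hσ : σ ∈ F.cones) :
    ∃ B : Finset N, coneOf B = σ ∧ LinearIndepOn ℝ (toReal : N → ℝ ⊗[ℤ] N) (B : Set N) ∧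
      (∀ v ∈ B, ∃ i, a i = v) ∧ ∀ i, toReal (a i) ∈ σ → a i ∈ B := by
  classical
  obtain ⟨A, rfl, hA⟩ := hF σ hσ
  have hA0 : ∀ v ∈ A, toReal v ≠ 0 := fun v hv => hA.ne_zero hv
  -- A generator spans a one-dimensional face, hence a cone of the fan, so it is a positive multiple
  -- of some listed `a i`.
  have hray : ∀ v : A, ∃ i, coneOf {a i} = coneOf {(v : N)} := fun v => by
    obtain ⟨i, -, hi⟩ := ha.2.2.2 (⟨F.face_mem _ hσ _ (isFace_coneOf_singleton hA v.2),
      isOneDimensional_coneOf_singleton (hA0 v v.2)⟩ :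
        coneOf {(v : N)} ∈ {σ | σ ∈ F.cones ∧ IsOneDimensional σ})
    exact ⟨i, hi⟩
  choose p hp using hray
  choose c hc hpc using fun v : A =>
    exists_pos_smul_of_coneOf_singleton_eq (hp v) (ha.toReal_ne_zero _)
  have hlin : LinearIndependent ℝ (fun v : A => toReal (a (p v))) := by
    have h := LinearIndependent.units_smul (show LinearIndependent ℝ (fun v : A => toReal (v : N))
      from hA) (fun v => Units.mk0 (c v) (hc v).ne')
    convert h using 2 with v
    exact hpc v
  have hmem : ∀ v : A, toReal (a (p v)) ∈ coneOf A := fun v => by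
    rw [hpc]
    exact smul_mem_cone _ (hc v).le (toReal_mem_coneOf v.2)
  have hB : coneOf (Finset.univ.image fun v : A => a (p v)) = coneOf A := by
    apply le_antisymm
    · refine Submodule.span_le.2 ?_
      rintro _ ⟨w, hw, rfl⟩
      obtain ⟨v, -, rfl⟩ := Finset.mem_image.1 (Finset.mem_coe.1 hw)
      exact hmem v
    · refine Submodule.span_le.2 ?_
      rintro _ ⟨w, hw, rfl⟩
      have e : toReal w = (c ⟨w, hw⟩)⁻¹ • toReal (a (p ⟨w, hw⟩)) := by
        rw [hpc, smul_smul, inv_mul_cancel₀ (hc _).ne', one_smul]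
      rw [e]
      exact smul_mem_cone _ (inv_nonneg.2 (hc _).le) (toReal_mem_coneOf (Finset.mem_image_of_mem
        (fun v : A => a (p v)) (Finset.mem_univ (⟨w, hw⟩ : A))))
  refine ⟨_, hB, ?_, ?_, ?_⟩
  · rw [Finset.coe_image]
    refine LinearIndepOn.image_of_comp (fun v : A => a (p v)) toReal ?_
    rw [Finset.coe_univ, linearIndepOn_univ_iff]
    exact hlin
  · intro v hv
    obtain ⟨w, -, rfl⟩ := Finset.mem_image.1 hv
    exact ⟨_, rfl⟩
  · intro i hi
    -- The ray of `a i` meets the cone in itself, so it is a face. Some generator occurs with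
    -- positive coefficient in `a i`, hence lies on this ray, and the two rays coincide.
    have hle : coneOf {a i} ≤ coneOf A := by
      refine Submodule.span_le.2 ?_
      rintro _ ⟨w, hw, rfl⟩
      rw [Finset.mem_singleton.1 (Finset.mem_coe.1 hw)]
      exact hi
    have hface := (F.inter_face _ (ha.coneOf_mem i) _ hσ).2
    rw [inf_eq_left.2 hle] at hface
    obtain ⟨d, hd, hdsum⟩ := mem_coneOf_iff.1 hi
    obtain ⟨v, hv, hdv⟩ : ∃ v ∈ A, 0 < d v := by
      by_contra! hcon
      refine ha.toReal_ne_zero i ?_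
      rw [← hdsum]
      refine Finset.sum_eq_zero fun v hv => ?_
      rw [le_antisymm (hcon v hv) (hd v), zero_smul]
    have hvmem : toReal v ∈ coneOf {a i} := hface.mem_of_sum_mem (fun v _ => hd v)
      (fun v hv _ => toReal_mem_coneOf hv)
      (by rw [hdsum]; exact toReal_mem_coneOf (Finset.mem_singleton_self _)) hv hdv
    obtain ⟨e, he, hev⟩ := mem_coneOf_singleton.1 hvmem
    have he0 : e ≠ 0 := by
      rintro rfl
      exact hA0 v hv (by rw [← hev, zero_smul])
    have hcone : coneOf {a i} = coneOf {a (p ⟨v, hv⟩)} := by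
      rw [hp]
      ext x
      rw [mem_coneOf_singleton, mem_coneOf_singleton]
      constructor
      · rintro ⟨r, hr, rfl⟩
        refine ⟨r * e⁻¹, mul_nonneg hr (inv_nonneg.2 he), ?_⟩
        rw [← hev, smul_smul, mul_assoc, inv_mul_cancel₀ he0, mul_one]
      · rintro ⟨r, hr, rfl⟩
        exact ⟨r * e, mul_nonneg hr he, by rw [← hev, smul_smul]⟩
    rw [ha.2.2.1 (Set.mem_univ i) (Set.mem_univ _) hcone]
    exact Finset.mem_image_of_mem (fun v : A => a (p v)) (Finset.mem_univ _)

/-- `gens` ranges over all minimal generator sets; since one of them consists of ray generators,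
only containment in the cone remains to be tested. -/
theorem gens_eq (ha : F.IsRayEnumeration a) (hF : F.IsSimplicial) (hσ : σ ∈ F.cones) :
    gens a σ = {i | toReal (a i) ∈ σ} := by
  ext i
  constructor
  · rintro ⟨A, hA, hi⟩
    exact hA.mem hi
  · intro hi
    obtain ⟨B, rfl, hB, -, h⟩ := exists_generators ha hF hσ
    exact ⟨B, isGeneratorSet_of_linearIndepOn hB, h i hi⟩

theorem IsRayEnumeration.injective (ha : F.IsRayEnumeration a) : Function.Injective a :=
  fun i j h => ha.2.2.1 (Set.mem_univ i) (Set.mem_univ j) (by simp only [h])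

theorem linearIndepOn_gens (ha : F.IsRayEnumeration a) (hF : F.IsSimplicial) (hσ : σ ∈ F.cones) :
    LinearIndepOn ℝ (fun i => toReal (a i)) (gens a σ) := by
  rw [gens_eq ha hF hσ]
  obtain ⟨B, rfl, hB, -, h⟩ := exists_generators ha hF hσ
  exact LinearIndependent.comp (show LinearIndependent ℝ (fun v : (B : Set N) => toReal (v : N))
      from hB) (fun i : {i | toReal (a i) ∈ coneOf B} => ⟨a i, h i i.2⟩)
    fun i j hij => Subtype.ext (ha.injective (congrArg Subtype.val hij))

theorem exists_nonneg_combination (ha : F.IsRayEnumeration a) (hF : F.IsSimplicial)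
    (hσ : σ ∈ F.cones) {x : ℝ ⊗[ℤ] N} (hx : x ∈ σ) :
    ∃ c : Fin m → ℝ, (∀ i, 0 ≤ c i) ∧ (∀ i, i ∉ gens a σ → c i = 0) ∧
      ∑ i, c i • toReal (a i) = x := by
  classical
  rw [gens_eq ha hF hσ]
  obtain ⟨B, rfl, hB, hBa, h⟩ := exists_generators ha hF hσ
  obtain ⟨c, hc, rfl⟩ := mem_coneOf_iff.1 hx
  refine ⟨fun i => if a i ∈ B then c (a i) else 0, fun i => ?_, fun i hi => ?_, ?_⟩
  · dsimp only
    split_ifs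
    exacts [hc _, le_rfl]
  · exact if_neg fun hiB => hi (toReal_mem_coneOf hiB)
  · simp only [ite_smul, zero_smul]
    rw [← Finset.sum_filter]
    refine Finset.sum_nbij a (fun i hi => (Finset.mem_filter.1 hi).2) ha.injective.injOn
      (fun v hv => ?_) fun _ _ => rfl
    obtain ⟨i, rfl⟩ := hBa v hv
    exact ⟨i, by simpa using hv, rfl⟩

end Fan

/-! ### Relations between ray generators; completeness -/

namespace Fan

variable {N : Type*} [AddCommGroup N] {m : ℕ} {F : Fan N} {a : Fin m → N}
  {σ : PointedCone ℝ (ℝ ⊗[ℤ] N)}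

theorem mem_of_mem_gens {i : Fin m} (h : i ∈ gens a σ) : toReal (a i) ∈ σ := by
  obtain ⟨A, hA, hi⟩ := h
  exact hA.mem hi

/-- The cones over the g-subsets embed into `N_ℝ`: a linear relation between the ray generators
whose positive and negative parts are supported on g-subsets is trivial. -/
theorem eq_zero_of_sum_smul_eq_zero (ha : F.IsRayEnumeration a) (hF : F.IsSimplicial)
    {ξ : Fin m → ℝ} (h0 : ∑ i, ξ i • toReal (a i) = 0) (hpos : F.IsGSubset a {i | 0 < ξ i})
    (hneg : F.IsGSubset a {i | ξ i < 0}) : ξ = 0 := by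
  obtain ⟨σ, hσ, hpσ⟩ := hpos
  obtain ⟨τ, hτ, hnτ⟩ := hneg
  have hsplit : ∑ i, (ξ i)⁺ • toReal (a i) = ∑ i, (ξ i)⁻ • toReal (a i) := by
    rw [← sub_eq_zero, ← Finset.sum_sub_distrib, ← h0]
    refine Finset.sum_congr rfl fun i _ => ?_
    rw [← sub_smul, posPart_sub_negPart]
  have hp : ∀ i, 0 < (ξ i)⁺ → toReal (a i) ∈ σ := fun i hi =>
    mem_of_mem_gens (hpσ (show 0 < ξ i from posPart_pos_iff.1 hi))
  have hn : ∀ i, 0 < (ξ i)⁻ → toReal (a i) ∈ τ := fun i hi =>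
    mem_of_mem_gens (hnτ (show ξ i < 0 from negPart_pos_iff.1 hi))
  have hxσ : ∑ i, (ξ i)⁺ • toReal (a i) ∈ σ := Submodule.sum_mem _ fun i _ => by
    rcases (posPart_nonneg (ξ i)).eq_or_lt with h | h
    · rw [← h, zero_smul]
      exact zero_mem _
    · exact smul_mem_cone _ h.le (hp i h)
  have hxτ : ∑ i, (ξ i)⁻ • toReal (a i) ∈ τ := Submodule.sum_mem _ fun i _ => by
    rcases (negPart_nonneg (ξ i)).eq_or_lt with h | h
    · rw [← h, zero_smul]
      exact zero_mem _
    · exact smul_mem_cone _ h.le (hn i h)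
  obtain ⟨hfσ, hfτ⟩ := F.inter_face σ hσ τ hτ
  have hmem : ∀ i, ξ i ≠ 0 → i ∈ gens a (σ ⊓ τ) := fun i hi => by
    rw [gens_eq ha hF (F.face_mem _ hσ _ hfσ)]
    rcases hi.lt_or_gt with h | h
    · exact hfτ.mem_of_sum_mem (fun i _ => negPart_nonneg (ξ i)) (fun i _ => hn i)
        ⟨hsplit ▸ hxσ, hxτ⟩ (Finset.mem_univ i) (negPart_pos_iff.2 h)
    · exact hfσ.mem_of_sum_mem (fun i _ => posPart_nonneg (ξ i)) (fun i _ => hp i)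
        ⟨hxσ, hsplit ▸ hxτ⟩ (Finset.mem_univ i) (posPart_pos_iff.2 h)
  -- With f(a_i) = ξ_i on the support of ξ, applying f to the relation gives ∑ ξ_i² = 0.
  obtain ⟨f, hf⟩ := exists_dual_of_linearIndepOn
    (linearIndepOn_gens ha hF (F.face_mem _ hσ _ hfσ)) ξ
  have h1 := congrArg f h0
  simp only [map_sum, map_smul, smul_eq_mul, map_zero] at h1
  have h2 : ∀ i, ξ i * f (toReal (a i)) = ξ i * ξ i := fun i => by
    by_cases hi : ξ i = 0
    · rw [hi, zero_mul, zero_mul]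
    · rw [hf i (hmem i hi)]
  simp only [h2] at h1
  rw [Finset.sum_eq_zero_iff_of_nonneg fun i _ => mul_self_nonneg _] at h1
  exact funext fun i => mul_self_eq_zero.1 (h1 i (Finset.mem_univ i))

/-- In a complete fan a ray of the form `u + n w`, where `w` is in the relative interior of the
cone spanned by the g-subset `I`, ends in a cone having `I` among its generators. -/
theorem exists_cone_of_isComplete (ha : F.IsRayEnumeration a) (hF : F.IsSimplicial)
    (hc : F.IsComplete) {I : Finset (Fin m)} (hI : F.IsGSubset a I) (u : ℝ ⊗[ℤ] N) :
    ∃ (σ : PointedCone ℝ (ℝ ⊗[ℤ] N)) (n : ℕ), σ ∈ F.cones ∧ ↑I ⊆ gens a σ ∧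
      u + (n : ℝ) • ∑ i ∈ I, toReal (a i) ∈ σ := by
  classical
  set w := ∑ i ∈ I, toReal (a i) with hw
  choose s hs hus using fun n : ℕ => hc (u + (n : ℝ) • w)
  -- Pigeonhole: finitely many cones, so one of them contains u + n w for infinitely many n.
  have := F.finite.to_subtype
  obtain ⟨⟨σ, hσ⟩, hinf⟩ := Finite.exists_infinite_fiber (fun n => (⟨s n, hs n⟩ : F.cones))
  rw [Set.infinite_coe_iff] at hinf
  have hmem : ∀ n ∈ (fun n => (⟨s n, hs n⟩ : F.cones)) ⁻¹' {⟨σ, hσ⟩}, u + (n : ℝ) • w ∈ σ :=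
    fun n hn => by
      have h : s n = σ := congrArg Subtype.val hn
      exact h ▸ hus n
  obtain ⟨n, hn⟩ := hinf.nonempty
  obtain ⟨k, hk, hnk⟩ := hinf.exists_gt n
  -- As a difference quotient of two such points, w is in the span of σ. A negative coordinate of w
  -- would make that coordinate of u + l w negative for large l.
  have hwσ : w ∈ σ := by
    obtain ⟨c, -, hcg, hcn⟩ := exists_nonneg_combination ha hF hσ (hmem n hn)
    obtain ⟨d, -, hdg, hdk⟩ := exists_nonneg_combination ha hF hσ (hmem k hk)
    have hkn : (0 : ℝ) < k - n := sub_pos.2 (Nat.cast_lt.2 hnk)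
    have hcomb : ∑ i, ((k - n : ℝ)⁻¹ * (d i - c i)) • toReal (a i) = w := by
      simp only [mul_smul, sub_smul, ← Finset.smul_sum, Finset.sum_sub_distrib, hcn, hdk]
      rw [add_sub_add_left_eq_sub, ← sub_smul, smul_smul, inv_mul_cancel₀ hkn.ne', one_smul]
    rw [← hcomb]
    refine Submodule.sum_mem _ fun i _ => ?_
    by_cases hi : i ∈ gens a σ
    · refine smul_mem_cone _ ?_ (mem_of_mem_gens hi)
      obtain ⟨f, hf⟩ := exists_dual_of_linearIndepOn (linearIndepOn_gens ha hF hσ)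
        (fun j => if j = i then 1 else 0)
      have hfc : ∀ e : Fin m → ℝ, (∀ j, j ∉ gens a σ → e j = 0) →
          f (∑ j, e j • toReal (a j)) = e i := fun e he => by
        rw [map_sum, Finset.sum_eq_single i]
        · simp [hf i hi]
        · intro j _ hj
          by_cases hjg : j ∈ gens a σ
          · simp [hf j hjg, hj]
          · simp [he j hjg]
        · exact fun h => absurd (Finset.mem_univ i) h
      rw [← hfc (fun j => (k - n : ℝ)⁻¹ * (d j - c j)) fun j hj => by
        simp [hcg j hj, hdg j hj], hcomb]
      by_contra! hneg
      obtain ⟨M, hM⟩ := exists_nat_gt (f u / (-f w))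
      obtain ⟨l, hl, hMl⟩ := hinf.exists_gt M
      obtain ⟨e, he, heg, hel⟩ := exists_nonneg_combination ha hF hσ (hmem l hl)
      have h1 : 0 ≤ f u + l * f w := by
        have := he i
        rw [← hfc e heg, hel] at this
        simpa using this
      rw [div_lt_iff₀ (neg_pos.2 hneg)] at hM
      have h2 : (M : ℝ) < l := Nat.cast_lt.2 hMl
      nlinarith
    · rw [hcg i hi, hdg i hi, sub_zero, mul_zero, zero_smul]
      exact zero_mem _
  refine ⟨σ, n, hσ, fun i hi => ?_, hmem n hn⟩
  -- w is the sum of the a_i, i ∈ I, with coefficients 1, and lies in a face of τ; hence every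
  -- summand lies in that face, and so in σ.
  obtain ⟨τ, hτ, hIτ⟩ := hI
  have hwτ : w ∈ τ := Submodule.sum_mem _ fun i hi => mem_of_mem_gens (hIτ hi)
  have h := (F.inter_face σ hσ τ hτ).2.mem_of_sum_mem (s := I) (c := fun _ => 1)
    (w := fun i => toReal (a i)) (fun _ _ => zero_le_one) (fun i hi _ => mem_of_mem_gens (hIτ hi))
    (by simpa only [one_smul] using ⟨hwσ, hwτ⟩) hi one_pos
  rw [gens_eq ha hF hσ]
  exact h.1

/-- Subtract from n on I and y off I the coefficients of the point in the cone reached. With y =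
-log|z| and I the zero set of z, the bound says that the scaled moduli are at most 1, with equality
off the generators. -/
theorem exists_relation_of_isComplete (ha : F.IsRayEnumeration a) (hF : F.IsSimplicial)
    (hc : F.IsComplete) {I : Finset (Fin m)} (hI : F.IsGSubset a I) (y : Fin m → ℝ) :
    ∃ ξ : Fin m → ℝ, ∑ i, ξ i • toReal (a i) = 0 ∧ ∃ σ ∈ F.cones, ↑I ⊆ gens a σ ∧
      ∀ i ∉ I, ξ i ≤ y i ∧ (i ∉ gens a σ → ξ i = y i) := by
  classical
  obtain ⟨σ, n, hσ, hIσ, hmem⟩ := exists_cone_of_isComplete ha hF hc hI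
    (∑ i ∈ Iᶜ, y i • toReal (a i))
  obtain ⟨c, hc0, hcg, hcx⟩ := exists_nonneg_combination ha hF hσ hmem
  refine ⟨fun i => (if i ∈ I then (n : ℝ) else y i) - c i, ?_, σ, hσ, hIσ, fun i hi => ?_⟩
  · simp only [sub_smul, Finset.sum_sub_distrib]
    rw [hcx, sub_eq_zero, ← Finset.sum_add_sum_compl I, add_comm, Finset.smul_sum]
    congr 1
    · refine Finset.sum_congr rfl fun i hi => ?_
      rw [if_neg (Finset.mem_compl.1 hi)]
    · refine Finset.sum_congr rfl fun i hi => ?_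
      rw [if_pos hi]
  · dsimp only
    rw [if_neg hi]
    exact ⟨by linarith [hc0 i], fun h => by rw [hcg i h, sub_zero]⟩

end Fan

/-! ### The groups G and K: characters and polar decomposition -/

section Torus

variable {N : Type*} [AddCommGroup N] {m : ℕ} {a : Fin m → N}

/-- Expand in a basis of the free lattice. Applied to ℂˣ, 𝕊¹ and ℝ, this describes G, K and the real
relations by the same equations. -/
theorem sum_tmul_eq_zero_iff [Module.Free ℤ N] [Module.Finite ℤ N] {C : Type*} [AddCommGroup C]
    (c : Fin m → C) :
    ∑ i, a i ⊗ₜ[ℤ] c i = 0 ↔ ∀ φ : N →ₗ[ℤ] ℤ, ∑ i, φ (a i) • c i = 0 := by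
  constructor
  · intro h φ
    have := congrArg ((TensorProduct.lid ℤ C).toLinearMap ∘ₗ φ.rTensor C) h
    simpa using this
  · intro h
    let b := Module.Free.chooseBasis ℤ N
    calc ∑ i, a i ⊗ₜ[ℤ] c i = ∑ i, ∑ j, b j ⊗ₜ[ℤ] (b.coord j (a i) • c i) := by
          refine Finset.sum_congr rfl fun i _ => ?_
          conv_lhs => rw [← b.sum_repr (a i)]
          simp only [TensorProduct.sum_tmul, TensorProduct.smul_tmul, Module.Basis.coord_apply]
      _ = ∑ j, b j ⊗ₜ[ℤ] ∑ i, b.coord j (a i) • c i := by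
          rw [Finset.sum_comm]
          simp only [TensorProduct.tmul_sum]
      _ = 0 := by simp only [h, TensorProduct.tmul_zero, Finset.sum_const_zero]

theorem mem_ker_torusMap_iff [Module.Free ℤ N] [Module.Finite ℤ N] {C : Type*} [CommGroup C]
    {t : Fin m → C} :
    t ∈ (torusMap a C).ker ↔ ∀ φ : N →ₗ[ℤ] ℤ, ∏ i, t i ^ φ (a i) = 1 :=
  sum_tmul_eq_zero_iff (fun i => Additive.ofMul (t i))

theorem sum_smul_toReal_eq_zero_iff [Module.Free ℤ N] [Module.Finite ℤ N] {ξ : Fin m → ℝ} :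
    ∑ i, ξ i • toReal (a i) = 0 ↔ ∀ φ : N →ₗ[ℤ] ℤ, ∑ i, φ (a i) * ξ i = 0 := by
  have h := sum_tmul_eq_zero_iff (a := a) ξ
  simp only [zsmul_eq_mul] at h
  rw [← h, ← (TensorProduct.comm ℤ N ℝ).map_eq_zero_iff]
  simp [toReal, TensorProduct.smul_tmul']

/-- The coordinatewise exponential `ℝ^m → (ℂ^*)^m`. -/
noncomputable def expUnits (ξ : Fin m → ℝ) : Fin m → ℂˣ :=
  fun i => Units.mk0 (Real.exp (ξ i) : ℂ) (Complex.ofReal_ne_zero.2 (Real.exp_pos _).ne')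

@[simp]
theorem coe_expUnits (ξ : Fin m → ℝ) (i : Fin m) : (expUnits ξ i : ℂ) = (Real.exp (ξ i) : ℂ) := rfl

theorem expUnits_add (ξ η : Fin m → ℝ) : expUnits (ξ + η) = expUnits ξ * expUnits η := by
  ext i
  simp [Real.exp_add]

theorem expUnits_zero : expUnits (0 : Fin m → ℝ) = 1 := by
  ext i
  simp

theorem expUnits_neg (ξ : Fin m → ℝ) : expUnits (-ξ) = (expUnits ξ)⁻¹ := by
  rw [eq_inv_iff_mul_eq_one, ← expUnits_add, neg_add_cancel, expUnits_zero]

theorem exp_intCast_mul (n : ℤ) (x : ℝ) : Real.exp (n * x) = Real.exp x ^ n := by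
  exact_mod_cast Complex.exp_int_mul x n

theorem expUnits_mem_groupG_iff [Module.Free ℤ N] [Module.Finite ℤ N] {ξ : Fin m → ℝ} :
    expUnits ξ ∈ groupG a ↔ ∑ i, ξ i • toReal (a i) = 0 := by
  rw [groupG, mem_ker_torusMap_iff, sum_smul_toReal_eq_zero_iff]
  refine forall_congr' fun φ => ?_
  rw [Units.ext_iff, ← Real.exp_eq_one_iff, Real.exp_sum, ← Complex.ofReal_inj]
  simp only [exp_intCast_mul]
  push_cast
  simp

/-- The coordinatewise logarithm of the modulus `(ℂ^*)^m → ℝ^m`. -/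
noncomputable def logNorm (g : Fin m → ℂˣ) : Fin m → ℝ := fun i => Real.log ‖(g i : ℂ)‖

theorem norm_eq_exp_logNorm (g : Fin m → ℂˣ) (i : Fin m) :
    ‖(g i : ℂ)‖ = Real.exp (logNorm g i) :=
  (Real.exp_log (norm_pos_iff.2 (g i).ne_zero)).symm

/-- The absolute value of each character equation reads exp(∑ φ(a_i) log|g_i|) = 1, and the real
exponential is 1 only at 0. -/
theorem sum_logNorm_smul [Module.Free ℤ N] [Module.Finite ℤ N] {g : Fin m → ℂˣ}
    (hg : g ∈ groupG a) : ∑ i, logNorm g i • toReal (a i) = 0 := by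
  rw [groupG, mem_ker_torusMap_iff] at hg
  rw [sum_smul_toReal_eq_zero_iff]
  intro φ
  have h := congrArg (fun z : ℂˣ => ‖(z : ℂ)‖) (hg φ)
  simp only [Units.coe_prod, Units.val_zpow_eq_zpow_val, norm_prod, norm_zpow,
    norm_eq_exp_logNorm, Units.val_one, norm_one, ← exp_intCast_mul] at h
  rw [← Real.exp_sum] at h
  exact (Real.exp_eq_one_iff _).1 h

theorem torusIncl_mem_groupG_iff [Module.Free ℤ N] [Module.Finite ℤ N] {t : Fin m → Circle} :
    torusIncl m t ∈ groupG a ↔ t ∈ groupK a := by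
  rw [groupG, groupK, mem_ker_torusMap_iff, mem_ker_torusMap_iff]
  refine forall_congr' fun φ => ?_
  have h : ∏ i, torusIncl m t i ^ φ (a i) = Circle.toUnits (∏ i, t i ^ φ (a i)) := by
    simp only [map_prod, map_zpow]
    rfl
  rw [h]
  exact map_eq_one_iff Circle.toUnits unitSphereToUnits_injective

theorem exists_polar [Module.Free ℤ N] [Module.Finite ℤ N] {g : Fin m → ℂˣ}
    (hg : g ∈ groupG a) : ∃ t ∈ groupK a, g = torusIncl m t * expUnits (logNorm g) := by
  have h : ∀ i, ((g * expUnits (-logNorm g)) i : ℂ) ∈ Submonoid.unitSphere ℂ := fun i => by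
    change _ ∈ Metric.sphere (0 : ℂ) 1
    rw [mem_sphere_zero_iff_norm, Pi.mul_apply, Units.val_mul, norm_mul, norm_eq_exp_logNorm,
      coe_expUnits, Complex.norm_real, Real.norm_of_nonneg (Real.exp_pos _).le, ← Real.exp_add]
    simp
  have e : torusIncl m (fun i => (⟨_, h i⟩ : Circle)) = g * expUnits (-logNorm g) := by
    ext i
    rfl
  have hG : expUnits (-logNorm g) ∈ groupG a := by
    rw [expUnits_neg]
    exact inv_mem (expUnits_mem_groupG_iff.2 (sum_logNorm_smul hg))
  refine ⟨_, torusIncl_mem_groupG_iff.1 (e ▸ mul_mem hg hG), ?_⟩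
  rw [e, expUnits_neg, inv_mul_cancel_right]

end Torus

/-! ### Pointwise criteria for U and Z, and the deformation retraction -/

namespace Fan

variable {N : Type*} [AddCommGroup N] {m : ℕ} {F : Fan N} {a : Fin m → N}

theorem IsGSubset.mono {I J : Set (Fin m)} (h : F.IsGSubset a J) (hIJ : I ⊆ J) :
    F.IsGSubset a I := by
  obtain ⟨σ, hσ, hJ⟩ := h
  exact ⟨σ, hσ, hIJ.trans hJ⟩

theorem mem_U_iff {z : Fin m → ℂ} : z ∈ F.U a ↔ F.IsGSubset a {i | z i = 0} := by
  change z ∈ (F.arrangement a)ᶜ ↔ _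
  simp only [arrangement, Set.mem_compl_iff, Set.mem_iUnion, Set.mem_ofPred_eq, not_exists]
  constructor
  · intro h
    by_contra hI
    exact h _ hI fun i hi => hi
  · intro h I hI hz
    exact hI (h.mono hz)

theorem mem_Z_iff {z : Fin m → ℂ} :
    z ∈ F.Z a ↔ (∀ i, ‖z i‖ ≤ 1) ∧ F.IsGSubset a {i | ‖z i‖ < 1} := by
  change z ∈ ⋃ σ ∈ F.cones, ZCone a σ ↔ _
  rw [Set.mem_iUnion₂]
  constructor
  · rintro ⟨σ, hσ, h1, h2⟩
    exact ⟨h1, σ, hσ, fun i hi => by_contra fun h => (hi : ‖z i‖ < 1).ne (h2 i h)⟩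
  · rintro ⟨h1, σ, hσ, h2⟩
    exact ⟨σ, hσ, h1, fun i hi => (h1 i).antisymm (not_lt.1 fun h => hi (h2 h))⟩

theorem isClosed_Z : IsClosed (F.Z a : Set (Fin m → ℂ)) := by
  refine F.finite.isClosed_biUnion fun σ _ => ?_
  have h : ZCone a σ = (⋂ j, {z | ‖z j‖ ≤ 1}) ∩ ⋂ j, ⋂ (_ : j ∉ gens a σ), {z | ‖z j‖ = 1} := by
    ext z
    simp [ZCone]
  rw [h]
  refine (isClosed_iInter fun j => ?_).inter (isClosed_iInter fun j => isClosed_iInter fun _ => ?_)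
  · exact isClosed_le (by fun_prop) continuous_const
  · exact isClosed_eq (by fun_prop) continuous_const

section Retraction

open scoped Classical in
/-- The minimum of `1` and of the numbers `max_{i ∈ J} |z_i|` over all `J` which are not
g-subsets. -/
noncomputable def level (F : Fan N) (a : Fin m → N) (z : Fin m → ℂ) : NNReal :=
  Finset.univ.inf' Finset.univ_nonempty fun J : Finset (Fin m) =>
    if F.IsGSubset a J then 1 else min 1 (J.sup fun i => ‖z i‖₊)

theorem continuous_level : Continuous (level F a) := by
  classical
  refine Continuous.finset_inf'_apply _ fun J _ => ?_
  split_ifs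
  · exact continuous_const
  · exact continuous_const.min (Continuous.finset_sup_apply fun i _ => by fun_prop)

theorem level_le_one (z : Fin m → ℂ) : level F a z ≤ 1 := by
  classical
  refine (Finset.inf'_le _ (Finset.mem_univ ∅)).trans ?_
  split_ifs
  exacts [le_rfl, min_le_left _ _]

theorem level_pos {z : Fin m → ℂ} (hz : z ∈ F.U a) : 0 < level F a z := by
  classical
  refine (Finset.lt_inf'_iff _).2 fun J _ => ?_
  split_ifs with hJ
  · exact one_pos
  · refine lt_min one_pos (Finset.lt_sup_iff.2 ?_)
    by_contra! h
    refine hJ ((mem_U_iff.1 hz).mono fun i hi => ?_)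
    simpa using h i hi

/-- Otherwise this set takes part in the minimum, so the level is at most the maximum of moduli all
strictly below it. -/
theorem isGSubset_lt_level {z : Fin m → ℂ} (hz : z ∈ F.U a) :
    F.IsGSubset a {i | ‖z i‖ < level F a z} := by
  classical
  by_contra h
  let J : Finset (Fin m) := Finset.univ.filter fun i => ‖z i‖ < level F a z
  have hJ : (J : Set (Fin m)) = {i | ‖z i‖ < level F a z} := by
    ext i
    simp [J]
  rw [← hJ] at h
  have h1 : level F a z ≤ J.sup fun i => ‖z i‖₊ := by
    refine (Finset.inf'_le _ (Finset.mem_univ J)).trans ?_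
    rw [if_neg h]
    exact min_le_right _ _
  refine h1.not_gt ((Finset.sup_lt_iff (level_pos hz)).2 fun i hi => ?_)
  exact_mod_cast (Finset.mem_filter.1 hi).2

theorem level_eq_one {z : Fin m → ℂ} (hz : z ∈ F.Z a) : level F a z = 1 := by
  classical
  refine (level_le_one z).antisymm (Finset.le_inf' _ _ fun J _ => ?_)
  split_ifs with hJ
  · exact le_rfl
  · refine le_min le_rfl ?_
    by_contra! h
    refine hJ ((mem_Z_iff.1 hz).2.mono fun i hi => ?_)
    exact_mod_cast (Finset.le_sup (f := fun i => ‖z i‖₊) hi).trans_lt h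

/-- The positive scaling factors retracting `U(Σ)` onto `Z(Σ)`. -/
noncomputable def scaling (F : Fan N) (a : Fin m → N) (z : Fin m → ℂ) (i : Fin m) : ℝ :=
  (max ‖z i‖ (level F a z))⁻¹

theorem scaling_pos {z : Fin m → ℂ} (hz : z ∈ F.U a) (i : Fin m) : 0 < scaling F a z i :=
  inv_pos.2 (lt_max_of_lt_right (level_pos hz))

theorem scaling_mul_mem_Z {z : Fin m → ℂ} (hz : z ∈ F.U a) :
    (fun i => (scaling F a z i : ℂ) * z i) ∈ F.Z a := by
  have hpos : ∀ i, 0 < max ‖z i‖ (level F a z) := fun i => lt_max_of_lt_right (level_pos hz)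
  have hn : ∀ i, ‖(scaling F a z i : ℂ) * z i‖ = ‖z i‖ / max ‖z i‖ (level F a z) := fun i => by
    rw [norm_mul, Complex.norm_real, Real.norm_of_nonneg (scaling_pos hz i).le, scaling,
      inv_mul_eq_div]
  refine mem_Z_iff.2 ⟨fun i => ?_, (isGSubset_lt_level hz).mono fun i hi => ?_⟩
  · rw [hn]
    exact div_le_one_of_le₀ (le_max_left _ _) (hpos i).le
  · rw [Set.mem_ofPred_eq, hn, div_lt_one (hpos i)] at hi
    simpa using hi

theorem scaling_eq_one {z : Fin m → ℂ} (hz : z ∈ F.Z a) (i : Fin m) : scaling F a z i = 1 := by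
  rw [scaling, level_eq_one hz, NNReal.coe_one, max_eq_right ((mem_Z_iff.1 hz).1 i), inv_one]

theorem continuous_scaling (i : Fin m) : Continuous fun z : F.U a => scaling F a z i := by
  have h : Continuous fun z : F.U a => (level F a z : ℝ) :=
    NNReal.continuous_coe.comp (continuous_level.comp continuous_subtype_val)
  have h' : Continuous fun z : F.U a => ‖(z : Fin m → ℂ) i‖ :=
    ((continuous_apply i).comp continuous_subtype_val).norm
  exact (h'.max h).inv₀ fun z =>
    (lt_max_of_lt_right (NNReal.coe_pos.2 (level_pos z.2)) : (0 : ℝ) < max _ _).ne'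

theorem norm_torusIncl_smul (t : Fin m → Circle) (z : Fin m → ℂ) (i : Fin m) :
    ‖(torusIncl m t • z) i‖ = ‖z i‖ := by
  change ‖(t i : ℂ) * z i‖ = _
  rw [norm_mul, Circle.norm_coe, one_mul]

theorem scaling_torusIncl_smul (t : Fin m → Circle) (z : Fin m → ℂ) :
    scaling F a (torusIncl m t • z) = scaling F a z := by
  have hl : level F a (torusIncl m t • z) = level F a z := by
    have h : ∀ i, ‖(torusIncl m t • z) i‖₊ = ‖z i‖₊ := fun i =>
      NNReal.eq (norm_torusIncl_smul t z i)
    simp only [level, h]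
  funext i
  rw [scaling, scaling, hl, norm_torusIncl_smul]

/-- The retraction of `U(Σ)` to `Z(Σ)` moving every point along a straight line. -/
noncomputable def retraction (F : Fan N) (a : Fin m → N) : C(unitInterval × F.U a, F.U a) where
  toFun p := ⟨fun i => (((1 - (p.1 : ℝ)) + p.1 * scaling F a p.2 i : ℝ) : ℂ) *
      (p.2 : Fin m → ℂ) i, by
    refine mem_U_iff.2 ((mem_U_iff.1 p.2.2).mono fun i hi => ?_)
    -- A positive factor leaves the zero set unchanged, so the path stays in U.
    have hpos : 0 < (1 - (p.1 : ℝ)) + p.1 * scaling F a p.2 i := by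
      have hs := scaling_pos p.2.2 i
      rcases p.1.2.1.eq_or_lt with h | h
      · rw [← h]
        norm_num
      · have := p.1.2.2
        have := mul_pos h hs
        linarith
    exact (mul_eq_zero.1 hi).resolve_left (Complex.ofReal_ne_zero.2 hpos.ne')⟩
  continuous_toFun := by
    refine Continuous.subtype_mk (continuous_pi fun i => ?_) _
    have h1 : Continuous fun p : unitInterval × F.U a => (p.1 : ℝ) :=
      continuous_subtype_val.comp continuous_fst
    have h2 : Continuous fun p : unitInterval × F.U a => scaling F a p.2 i :=
      (continuous_scaling i).comp continuous_snd
    have h3 : Continuous fun p : unitInterval × F.U a => (p.2 : Fin m → ℂ) i :=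
      (continuous_apply i).comp (continuous_subtype_val.comp continuous_snd)
    exact (Complex.continuous_ofReal.comp ((continuous_const.sub h1).add (h1.mul h2))).mul h3

theorem retraction_apply (s : unitInterval) (z : F.U a) (i : Fin m) :
    (retraction F a (s, z) : Fin m → ℂ) i =
      (((1 - (s : ℝ)) + s * scaling F a z i : ℝ) : ℂ) * (z : Fin m → ℂ) i := rfl

theorem retraction_zero (z : F.U a) : retraction F a (0, z) = z := by
  refine Subtype.ext (funext fun i => ?_)
  rw [retraction_apply]
  simp

theorem retraction_one_mem (z : F.U a) : (retraction F a (1, z) : Fin m → ℂ) ∈ F.Z a := by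
  convert scaling_mul_mem_Z z.2 using 2 with i
  rw [retraction_apply]
  simp

theorem retraction_inclZU (s : unitInterval) (z : F.Z a) :
    retraction F a (s, F.inclZU a z) = F.inclZU a z := by
  refine Subtype.ext (funext fun i => ?_)
  have h : scaling F a (F.inclZU a z : Fin m → ℂ) i = 1 := scaling_eq_one z.2 i
  rw [retraction_apply, h]
  simp

theorem retraction_smul (s : unitInterval) (t : Fin m → Circle) (z : F.U a) :
    retraction F a (s, torusIncl m t • z) = torusIncl m t • retraction F a (s, z) := by
  refine Subtype.ext (funext fun i => ?_)
  rw [retraction_apply]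
  have h : scaling F a ((torusIncl m t • z : F.U a) : Fin m → ℂ) = scaling F a z :=
    scaling_torusIncl_smul t _
  rw [h]
  change _ * ((torusIncl m t i : ℂ) * (z : Fin m → ℂ) i) =
    (torusIncl m t i : ℂ) * (retraction F a (s, z) : Fin m → ℂ) i
  rw [retraction_apply]
  ring

end Retraction

end Fan

/-! ### The homeomorphism of orbit spaces -/

namespace Fan

variable {N : Type*} [AddCommGroup N] {m : ℕ} {F : Fan N} {a : Fin m → N}

theorem norm_smul_apply (g : Fin m → ℂˣ) (z : Fin m → ℂ) (i : Fin m) :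
    ‖(g • z) i‖ = Real.exp (logNorm g i) * ‖z i‖ := by
  change ‖(g i : ℂ) * z i‖ = _
  rw [norm_mul, norm_eq_exp_logNorm]

theorem logNorm_expUnits (ξ : Fin m → ℝ) : logNorm (expUnits ξ) = ξ := by
  funext i
  rw [logNorm, coe_expUnits, Complex.norm_real, Real.norm_of_nonneg (Real.exp_pos _).le,
    Real.log_exp]

theorem norm_expUnits_smul_apply (ξ : Fin m → ℝ) (z : Fin m → ℂ) (i : Fin m) :
    ‖(expUnits ξ • z) i‖ = Real.exp (ξ i) * ‖z i‖ := by
  rw [norm_smul_apply, logNorm_expUnits]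

theorem exists_expUnits_smul_mem_Z (ha : F.IsRayEnumeration a) (hF : F.IsSimplicial)
    (hc : F.IsComplete) {z : Fin m → ℂ} (hz : z ∈ F.U a) :
    ∃ ξ : Fin m → ℝ, ∑ i, ξ i • toReal (a i) = 0 ∧ expUnits ξ • z ∈ F.Z a := by
  classical
  have hI : F.IsGSubset a (Finset.univ.filter fun i => z i = 0 : Finset (Fin m)) :=
    (mem_U_iff.1 hz).mono fun i hi => by simpa using hi
  obtain ⟨ξ, h0, σ, hσ, hIσ, h⟩ :=
    -- At z i = 0 the value is the default `log 0 = 0`; it is harmless, since the bounds concern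
    -- only nonzero coordinates.
    exists_relation_of_isComplete ha hF hc hI fun i => -Real.log ‖z i‖
  refine ⟨ξ, h0, mem_Z_iff.2 ⟨fun i => ?_, σ, hσ, fun i hi => ?_⟩⟩
  · rw [norm_expUnits_smul_apply]
    by_cases hzi : z i = 0
    · simp [hzi]
    · rw [← Real.exp_log (norm_pos_iff.2 hzi), ← Real.exp_add, Real.exp_le_one_iff]
      linarith [(h i (by simpa using hzi)).1]
  · by_contra hig
    have hzi : z i ≠ 0 := fun h => hig (hIσ (by simpa using h))
    rw [Set.mem_ofPred_eq, norm_expUnits_smul_apply, (h i (by simpa using hzi)).2 hig,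
      Real.exp_neg, Real.exp_log (norm_pos_iff.2 hzi),
      inv_mul_cancel₀ (norm_ne_zero_iff.2 hzi)] at hi
    exact lt_irrefl _ hi

variable [Module.Free ℤ N] [Module.Finite ℤ N]

/-- Where g expands, |z_i| < 1 because g • z has moduli at most 1; where g contracts, the modulus of
g • z is below 1. Both sets are therefore g-subsets. -/
theorem logNorm_eq_zero (ha : F.IsRayEnumeration a) (hF : F.IsSimplicial) {g : Fin m → ℂˣ}
    (hg : g ∈ groupG a) {z : Fin m → ℂ} (hz : z ∈ F.Z a) (hgz : g • z ∈ F.Z a) :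
    logNorm g = 0 := by
  obtain ⟨h1, h2⟩ := mem_Z_iff.1 hz
  obtain ⟨h3, h4⟩ := mem_Z_iff.1 hgz
  simp only [norm_smul_apply] at h3 h4
  refine eq_zero_of_sum_smul_eq_zero ha hF (sum_logNorm_smul hg) (h2.mono fun i hi => ?_)
    (h4.mono fun i hi => ?_)
  · have := Real.one_lt_exp_iff.2 (show 0 < logNorm g i from hi)
    change ‖z i‖ < 1
    nlinarith [h3 i, norm_nonneg (z i)]
  · have := Real.exp_lt_one_iff.2 (show logNorm g i < 0 from hi)
    change Real.exp (logNorm g i) * ‖z i‖ < 1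
    nlinarith [h1 i, norm_nonneg (z i), Real.exp_pos (logNorm g i)]

theorem isClosed_relations (a : Fin m → N) :
    IsClosed {ξ : Fin m → ℝ | ∑ i, ξ i • toReal (a i) = 0} := by
  simp only [sum_smul_toReal_eq_zero_iff, Set.ofPred_forall]
  exact isClosed_iInter fun φ => isClosed_eq (by fun_prop) continuous_const

/-- The action of the real part of `G` on `U(Σ)` is proper over the compact set `Z(Σ)`. -/
theorem not_tendsto_norm_atTop (ha : F.IsRayEnumeration a) (hF : F.IsSimplicial)
    {u : ℕ → Fin m → ℂ} {v : Fin m → ℂ} (hu : Tendsto u atTop (𝓝 v)) (hv : v ∈ F.U a)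
    {ξ : ℕ → Fin m → ℝ} (h0 : ∀ k, ∑ i, ξ k i • toReal (a i) = 0)
    (hZ : ∀ k, expUnits (ξ k) • u k ∈ F.Z a) : ¬ Tendsto (fun k => ‖ξ k‖) atTop atTop := by
  intro hinf
  -- Directions are placed in the ball, not the sphere, because `ξ k` may be 0 for some k.
  have hball : ∀ k, ‖ξ k‖⁻¹ • ξ k ∈ Metric.closedBall (0 : Fin m → ℝ) 1 := fun k => by
    rw [mem_closedBall_zero_iff, norm_smul, norm_inv, norm_norm]
    exact inv_mul_le_one
  obtain ⟨η, -, φ, hφ, hη⟩ := tendsto_subseq_of_bounded Metric.isBounded_closedBall hball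
  have hinf' : Tendsto (fun k => ‖ξ (φ k)‖) atTop atTop := hinf.comp hφ.tendsto_atTop
  have hu' : Tendsto (fun k => u (φ k)) atTop (𝓝 v) := hu.comp hφ.tendsto_atTop
  have hrel : ∑ i, η i • toReal (a i) = 0 :=
    (isClosed_relations a).mem_of_tendsto hη (Eventually.of_forall fun k => by
      simp only [Function.comp, Set.mem_ofPred_eq, Pi.smul_apply, smul_assoc, ← Finset.smul_sum,
        h0, smul_zero])
  have hne : η ≠ 0 := by
    rintro rfl
    have h1 : Tendsto (fun k => ‖‖ξ (φ k)‖⁻¹ • ξ (φ k)‖) atTop (𝓝 1) := by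
      refine tendsto_const_nhds.congr' ?_
      filter_upwards [hinf'.eventually_gt_atTop 0] with k hk
      rw [norm_smul, norm_inv, norm_norm, inv_mul_cancel₀ hk.ne']
    have h2 := tendsto_nhds_unique h1 hη.norm
    simp at h2
  have hξ : ∀ i, (fun k => ‖ξ (φ k)‖ * (‖ξ (φ k)‖⁻¹ • ξ (φ k)) i) =ᶠ[atTop]
      fun k => ξ (φ k) i := fun i => by
    filter_upwards [hinf'.eventually_gt_atTop 0] with k hk
    rw [Pi.smul_apply, smul_eq_mul, mul_inv_cancel_left₀ hk.ne']
  have hηi : ∀ i, Tendsto (fun k => (‖ξ (φ k)‖⁻¹ • ξ (φ k)) i) atTop (𝓝 (η i)) :=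
    fun i => (continuous_apply i).tendsto _ |>.comp hη
  have hui : ∀ i, Tendsto (fun k => ‖u (φ k) i‖) atTop (𝓝 ‖v i‖) :=
    fun i => ((continuous_apply i).tendsto _ |>.comp hu').norm
  -- Here ξ_i tends to +∞ while the scaled moduli stay at most 1, forcing v_i = 0.
  have hpos : F.IsGSubset a {i | 0 < η i} := by
    refine (mem_U_iff.1 hv).mono fun i hi => ?_
    have h1 : Tendsto (fun k => ξ (φ k) i) atTop atTop :=
      (hinf'.atTop_mul_pos hi (hηi i)).congr' (hξ i)
    have h2 : Tendsto (fun k => Real.exp (-ξ (φ k) i)) atTop (𝓝 0) :=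
      Real.tendsto_exp_neg_atTop_nhds_zero.comp h1
    have h3 : ‖v i‖ ≤ 0 := le_of_tendsto_of_tendsto' (hui i) h2 fun k => by
      have := (mem_Z_iff.1 (hZ (φ k))).1 i
      rw [norm_expUnits_smul_apply] at this
      rwa [Real.exp_neg, ← one_div, le_div_iff₀' (Real.exp_pos _)]
    exact norm_le_zero_iff.1 h3
  -- Here ξ_i tends to -∞, so the scaled moduli tend to 0 and one k serves all such i.
  have hneg : F.IsGSubset a {i | η i < 0} := by
    have hev : ∀ i, ∀ᶠ k in atTop, η i < 0 → ‖(expUnits (ξ (φ k)) • u (φ k)) i‖ < 1 := fun i => by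
      by_cases hi : η i < 0
      · have h1 : Tendsto (fun k => ξ (φ k) i) atTop atBot :=
          (hinf'.atTop_mul_neg hi (hηi i)).congr' (hξ i)
        have h2 := (Real.tendsto_exp_atBot.comp h1).mul (hui i)
        rw [zero_mul] at h2
        filter_upwards [h2.eventually_lt_const one_pos] with k hk _
        rw [norm_expUnits_smul_apply]
        exact hk
      · exact Eventually.of_forall fun k h => absurd h hi
    obtain ⟨k, hk⟩ := (eventually_all.2 hev).exists
    exact (mem_Z_iff.1 (hZ (φ k))).2.mono hk
  exact hne (eq_zero_of_sum_smul_eq_zero ha hF hrel hpos hneg)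

theorem eq_of_expUnits_smul_mem_Z (ha : F.IsRayEnumeration a) (hF : F.IsSimplicial)
    {z : Fin m → ℂ} {ξ η : Fin m → ℝ} (hξ : ∑ i, ξ i • toReal (a i) = 0)
    (hη : ∑ i, η i • toReal (a i) = 0) (hξZ : expUnits ξ • z ∈ F.Z a)
    (hηZ : expUnits η • z ∈ F.Z a) : ξ = η := by
  have e : expUnits ξ • z = expUnits (ξ - η) • expUnits η • z := by
    rw [smul_smul, ← expUnits_add, sub_add_cancel]
  rw [e] at hξZ
  have hG : expUnits (ξ - η) ∈ groupG a := by
    rw [sub_eq_add_neg, expUnits_add, expUnits_neg]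
    exact mul_mem (expUnits_mem_groupG_iff.2 hξ) (inv_mem (expUnits_mem_groupG_iff.2 hη))
  have := logNorm_eq_zero ha hF hG hηZ hξZ
  rwa [logNorm_expUnits, sub_eq_zero] at this

theorem continuous_expUnits_smul :
    Continuous fun p : (Fin m → ℝ) × (Fin m → ℂ) => expUnits p.1 • p.2 := by
  refine continuous_pi fun i => ?_
  change Continuous fun p : (Fin m → ℝ) × (Fin m → ℂ) => (Real.exp (p.1 i) : ℂ) * p.2 i
  fun_prop

/-- Non-escape gives a convergent subsequence of values; since Z is closed, its limit solves the
problem at the limit point, and uniqueness identifies it. -/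
theorem continuous_of_expUnits_smul_mem_Z (ha : F.IsRayEnumeration a) (hF : F.IsSimplicial)
    {ξ : F.U a → Fin m → ℝ} (h0 : ∀ u, ∑ i, ξ u i • toReal (a i) = 0)
    (hZ : ∀ u, expUnits (ξ u) • (u : Fin m → ℂ) ∈ F.Z a) : Continuous ξ := by
  refine continuous_iff_seqContinuous.2 fun u v hu => tendsto_of_subseq_tendsto fun n hn => ?_
  have huv : Tendsto (fun k => (u (n k) : Fin m → ℂ)) atTop (𝓝 v) :=
    (continuous_subtype_val.tendsto v).comp (hu.comp hn)
  have hbdd := not_tendsto_norm_atTop ha hF huv v.2 (fun k => h0 (u (n k))) fun k => hZ (u (n k))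
  simp only [tendsto_atTop, not_forall, not_eventually, not_le] at hbdd
  obtain ⟨R, hR⟩ := hbdd
  obtain ⟨η, -, φ, hφ, hη⟩ := tendsto_subseq_of_frequently_bounded
    (Metric.isBounded_closedBall (x := (0 : Fin m → ℝ)) (r := R)) (x := fun k => ξ (u (n k)))
    (hR.mono fun k hk => mem_closedBall_zero_iff.2 hk.le)
  have hηrel : ∑ i, η i • toReal (a i) = 0 :=
    (isClosed_relations a).mem_of_tendsto hη (Eventually.of_forall fun k => h0 _)
  have hηZ : expUnits η • (v : Fin m → ℂ) ∈ F.Z a :=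
    isClosed_Z.mem_of_tendsto ((continuous_expUnits_smul.tendsto (η, (v : Fin m → ℂ))).comp
      (hη.prodMk_nhds (huv.comp hφ.tendsto_atTop))) (Eventually.of_forall fun k => hZ _)
  rw [eq_of_expUnits_smul_mem_Z ha hF (h0 v) hηrel (hZ v) hηZ]
  exact ⟨φ, hη⟩

theorem exists_homeomorph (ha : F.IsRayEnumeration a) (hF : F.IsSimplicial) (hc : F.IsComplete) :
    ∃ h : F.ZModK a ≃ₜ F.UModG a,
      ∀ z : F.Z a, h (Quotient.mk _ z) = Quotient.mk _ (F.inclZU a z) := by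
  choose ξ h0 hZ using fun u : F.U a => exists_expUnits_smul_mem_Z ha hF hc u.2
  have hξ := continuous_of_expUnits_smul_mem_Z ha hF h0 hZ
  let r : F.U a → F.Z a := fun u => ⟨expUnits (ξ u) • (u : Fin m → ℂ), hZ u⟩
  have hr : Continuous r := Continuous.subtype_mk
    (continuous_expUnits_smul.comp (hξ.prodMk continuous_subtype_val)) _
  let f : F.ZModK a → F.UModG a := Quotient.lift (fun z => Quotient.mk _ (F.inclZU a z)) (by
    rintro _ z ⟨t, rfl⟩
    exact Quotient.sound ⟨⟨torusIncl m t, torusIncl_mem_groupG_iff.2 t.2⟩, rfl⟩)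
  let k : F.UModG a → F.ZModK a := Quotient.lift (fun u => Quotient.mk _ (r u)) (by
    rintro _ u ⟨g, rfl⟩
    obtain ⟨t, ht, hg⟩ := exists_polar g.2
    refine Quotient.sound ⟨⟨t, ht⟩, Subtype.ext ?_⟩
    have hsplit : ∀ η : Fin m → ℝ, expUnits η • (g : Fin m → ℂˣ) • (u : Fin m → ℂ) =
        torusIncl m t • expUnits (η + logNorm (g : Fin m → ℂˣ)) • (u : Fin m → ℂ) := fun η => by
      conv_lhs => rw [hg]
      rw [smul_smul, smul_smul, expUnits_add, mul_left_comm]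
    have hgZ : torusIncl m t • expUnits (ξ (g • u) + logNorm (g : Fin m → ℂˣ)) •
        (u : Fin m → ℂ) ∈ F.Z a := hsplit _ ▸ hZ (g • u)
    have hrel : ∑ i, (ξ (g • u) + logNorm (g : Fin m → ℂˣ)) i • toReal (a i) = 0 := by
      simp only [Pi.add_apply, add_smul, Finset.sum_add_distrib, h0, sum_logNorm_smul g.2, add_zero]
    -- The torus factor is dropped because membership in Z depends only on moduli; uniqueness gives
    -- ξ(g u) + log|g| = ξ(u), so r(g u) = t · r(u).
    have e := eq_of_expUnits_smul_mem_Z ha hF hrel (h0 u)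
      (by simpa only [mem_Z_iff, norm_torusIncl_smul] using hgZ) (hZ u)
    have h := hsplit (ξ (g • u))
    rw [e] at h
    exact h.symm)
  have hf : Continuous f := Continuous.quotient_lift
    (continuous_quot_mk.comp (continuous_subtype_val.subtype_mk _)) _
  have hk : Continuous k := Continuous.quotient_lift (continuous_quot_mk.comp hr) _
  refine ⟨⟨⟨f, k, ?_, ?_⟩, hf, hk⟩, fun z => rfl⟩
  · rintro ⟨z⟩
    refine congrArg (Quotient.mk _) (Subtype.ext ?_)
    have hone : expUnits (0 : Fin m → ℝ) • (z : Fin m → ℂ) = z := by rw [expUnits_zero, one_smul]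
    have e := eq_of_expUnits_smul_mem_Z ha hF (h0 (F.inclZU a z)) (η := 0) (by simp)
      (hZ (F.inclZU a z)) (hone.symm ▸ z.2)
    change expUnits (ξ (F.inclZU a z)) • (z : Fin m → ℂ) = z
    rw [e, hone]
  · rintro ⟨u⟩
    exact Quotient.sound ⟨⟨expUnits (ξ u), expUnits_mem_groupG_iff.2 (h0 u)⟩, rfl⟩

end Fan

end ToricKN

theorem theorem3p4 {N : Type*} [AddCommGroup N] [Module.Free ℤ N] [Module.Finite ℤ N]
    (F : ToricKN.Fan N) {m : ℕ} (a : Fin m → N) (ha : F.IsRayEnumeration a)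
    (hF : F.IsSimplicial) :
    (F.IsComplete →
      ∃ h : F.ZModK a ≃ₜ F.UModG a,
        ∀ z : F.Z a, h (Quotient.mk _ z) = Quotient.mk _ (F.inclZU a z)) ∧
    (∃ H : C(unitInterval × F.U a, F.U a),
      (∀ z, H (0, z) = z) ∧
      (∀ z, (H (1, z) : Fin m → ℂ) ∈ F.Z a) ∧
      (∀ (s : unitInterval) (z : F.Z a), H (s, F.inclZU a z) = F.inclZU a z) ∧
      (∀ (s : unitInterval) (t : Fin m → Circle) (z : F.U a),
        H (s, ToricKN.torusIncl m t • z) = ToricKN.torusIncl m t • H (s, z))) :=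
  ⟨ToricKN.Fan.exists_homeomorph ha hF, ToricKN.Fan.retraction F a, ToricKN.Fan.retraction_zero,
    ToricKN.Fan.retraction_one_mem, ToricKN.Fan.retraction_inclZU, ToricKN.Fan.retraction_smul⟩
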